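/- **Setting.** Consider $N$ players. Player $i$ chooses actions in a nonempty, compact, convex set $\mathcal X_i\subseteq\mathbb R^{n_i}$, and $\mathcal X=\prod_i\mathcal X_i$. Each cost $J_i:\mathcal X\to\mathbb R$ is continuously differentiable, and the game has a potential, i.e. a function $\Phi:\mathcal X\to\mathbb R$ with $J_i(u,x^{-i})-J_i(w,x^{-i})=\Phi(u,x^{-i})-\Phi(w,x^{-i})$ for all $i$, all $u,w\in\mathcal X_i$ and all $x^{-i}\in\prod_{j\ne i}\mathcal X_j$. The potential $\Phi$ is convex on $\mathcal X$ and $L$-smooth with respect to some norm (its gradient is $L$-Lipschitz from that norm to the dual norm), for some $L>0$. Player $i$ has a continuous regularizer $\psi_i:\mathcal X_i\to\mathbb R$ that is $\mu_i$-strongly convex with respect to some norm, $\mu_i>0$, and differentiable at the starting point $x_0^i$ below; its mirror map is $\nabla\psi_i^*(z)=\operatorname{argmax}_{u\in\mathcal X_i}\{\langle z,u\rangle-\psi_i(u)\}$. **Step sizes and delays.** For $k\ge1$ let $a_k=\dfrac{a_0}{(k+1)\log(k+1)}$ with a constant $a_0>0$, and let $A_k=\sum_{t=1}^k a_t$, $A_0=0$.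 The gradient $g_k^i=\nabla_{x^i}J_i(x_k)$ has a delay $d_k^i$ with $0\le d_k^i\le Dk^\alpha$ for all $i$ and all $k\ge1$, where $D>0$ and $\alpha>1$ are constants. **Algorithm.** Start with $x_0=x_1\in\mathcal X$, $z_0^i=\nabla\psi_i(x_0^i)$, $y_0=0$ and $s^i(0)=1$. At iteration $k\ge1$, player $i$ receives the messages $(t,g_t^i)$, $t\ge1$, with $k-1<t+d_t^i\le k$; $s^i(k)$ is the maximum of $s^i(k-1)$ and of the time stamps $t$ received at iteration $k$ (so $s^i(k)=s^i(k-1)$ if there are none). The player then sets $$z_k^i=z_{k-1}^i-a_k\,g^i_{s^i(k)},\qquad y_k^i=\frac{A_{k-1}}{A_k}y_{k-1}^i+\frac{a_k}{A_k}\nabla\psi_i^*(z_k^i),\qquad x_{k+1}^i=\frac{A_k}{A_{k+1}}y_k^i+\frac{a_{k+1}}{A_{k+1}}\nabla\psi_i^*(z_k^i).$$ **Claim.** For every minimizer $x_*$ of $\Phi$ over $\mathcal X$, $$\Phi(y_k)-\Phi(x_*)=O\!\left(\frac{\log\log\log k}{\log\log k}\right)\qquad(k\to\infty).$$ -/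

import Mathlib

open Filter Asymptotics

/-- `Φ` is a potential on `∏ i, X i` of the game with costs `J i`: a unilateral change of action of
player `i` changes `J i` and `Φ` by the same amount. -/
def IsPotential {N : ℕ} {E : Fin N → Type*} (X : ∀ i, Set (E i))
    (J : Fin N → (∀ i, E i) → ℝ) (Φ : (∀ i, E i) → ℝ) : Prop :=
  ∀ i, ∀ x ∈ Set.univ.pi X, ∀ u ∈ X i, ∀ w ∈ X i,
    J i (Function.update x i u) - J i (Function.update x i w) =
      Φ (Function.update x i u) - Φ (Function.update x i w)

/-- `f` is `L`-smooth on `S` with respect to the norm `p`: it has a gradient on `S` that is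
`L`-Lipschitz from `p` to the dual norm of `p` (the bound `‖ξ‖_* ≤ C` on the dual norm is written
as `|ξ v| ≤ C * p v` for all `v`). The set `S` may have empty interior, so that "gradient" means a
derivative relative to `S`. -/
def IsLSmoothOn {V : Type*} [NormedAddCommGroup V] [NormedSpace ℝ V] (p : Seminorm ℝ V) (L : ℝ)
    (S : Set V) (f : V → ℝ) : Prop :=
  ∃ f' : V → StrongDual ℝ V,
    (∀ x ∈ S, HasFDerivWithinAt f (f' x) S x) ∧
      ∀ x ∈ S, ∀ y ∈ S, ∀ v, |(f' x - f' y) v| ≤ L * p (x - y) * p v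

/-- `g i x` is the partial gradient `∇_{x^i} J_i (x^i; x^{-i})` at every profile `x ∈ ∏ i, X i`,
as an element of the dual of `E i`: the derivative at `x i`, relative to `X i`, of `J i` as a
function of the action of player `i` alone. (If `X i` lies in a proper affine subspace, then such a
gradient is determined only along `X i`; every choice is allowed.) -/
def IsPartialGradient {N : ℕ} {E : Fin N → Type*} [∀ i, NormedAddCommGroup (E i)]
    [∀ i, NormedSpace ℝ (E i)] (X : ∀ i, Set (E i)) (J : Fin N → (∀ i, E i) → ℝ)
    (g : ∀ i, (∀ j, E j) → StrongDual ℝ (E i)) : Prop :=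
  ∀ i, ∀ x ∈ Set.univ.pi X,
    HasFDerivWithinAt (fun u => J i (Function.update x i u)) (g i x) (X i) (x i)

/-- The mirror map `∇ψ^*(z) = argmax_{u ∈ X} (⟨z, u⟩ - ψ u)`. -/
noncomputable def mirrorMap {V : Type*} [NormedAddCommGroup V] [NormedSpace ℝ V] (X : Set V)
    (ψ : V → ℝ) (z : StrongDual ℝ V) : V :=
  Classical.epsilon fun v => v ∈ X ∧ IsMaxOn (fun u => z u - ψ u) X v

/-- The time stamps `t ≥ 1` of the feedback messages that arrive at the `k`-th iteration:
`k - 1 < t + d t ≤ k`. As delays are nonnegative, all of them satisfy `t ≤ k`. -/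
noncomputable def received (d : ℕ → ℝ) (k : ℕ) : Finset ℕ :=
  open Classical in
  (Finset.Icc 1 k).filter fun t => (k : ℝ) - 1 < (t : ℝ) + d t ∧ (t : ℝ) + d t ≤ (k : ℝ)

/-- The time stamp `s(k)` of the feedback used at iteration `k`: `s(0) = 1`, and `s(k)` is the
larger of `s(k-1)` and of the most recent time stamp received at iteration `k`, if there is one. -/
noncomputable def lastStamp (d : ℕ → ℝ) : ℕ → ℕ
  | 0 => 1
  | k + 1 => max (lastStamp d k) ((received d (k + 1)).sup id)

/-- `A_k = ∑_{t=1}^k a_t`, so that `A_0 = 0`. -/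
noncomputable def stepSum (a : ℕ → ℝ) (k : ℕ) : ℝ :=
  ∑ t ∈ Finset.Icc 1 k, a t

/-- The sequences `x`, `y`, `z` are produced by the players following the accelerated method with
delayed feedback: `x k i`, `y k i`, `z k i` belong to player `i` and iteration `k`, `a` are the step
sizes, `d i k` is the delay of the feedback of player `i` on the profile `x k`, and `g` is the first
order oracle (the partial gradients). -/
structure IsDelayedRun {N : ℕ} {E : Fin N → Type*} [∀ i, NormedAddCommGroup (E i)]
    [∀ i, NormedSpace ℝ (E i)] (X : ∀ i, Set (E i)) (ψ : ∀ i, E i → ℝ)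
    (g : ∀ i, (∀ j, E j) → StrongDual ℝ (E i)) (a : ℕ → ℝ) (d : Fin N → ℕ → ℝ)
    (x y : ℕ → ∀ i, E i) (z : ℕ → ∀ i, StrongDual ℝ (E i)) : Prop where
  x_zero_mem : ∀ i, x 0 i ∈ X i
  x_one : x 1 = x 0
  z_zero : ∀ i, HasFDerivWithinAt (ψ i) (z 0 i) (X i) (x 0 i)
  y_zero : y 0 = 0
  z_succ : ∀ k i, z (k + 1) i = z k i - a (k + 1) • g i (x (lastStamp (d i) (k + 1)))
  y_succ : ∀ k i, y (k + 1) i =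
    (stepSum a k / stepSum a (k + 1)) • y k i +
      (a (k + 1) / stepSum a (k + 1)) • mirrorMap (X i) (ψ i) (z (k + 1) i)
  x_succ : ∀ k i, x (k + 2) i =
    (stepSum a (k + 1) / stepSum a (k + 2)) • y (k + 1) i +
      (a (k + 2) / stepSum a (k + 2)) • mirrorMap (X i) (ψ i) (z (k + 1) i)

/-! Write A_k for `stepSum a k` and v_k for the profile of mirror points. Since y_k is the average
of v_1, ..., v_k with weights a_t, convexity gives A_n (Φ(y_n) − Φ(u)) ≤ ∑ a_k Φ'(y_k)(v_k − u)
(`ConvexOn.stepSum_mul_sub_le`). With the gradients actually fed to the mirror steps in place of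
Φ'(y_k), this sum would be bounded by a constant, because v_k is chosen after the k-th gradient has
been added (`be_the_leader`).

Those gradients are taken at stale points x_s. The potential makes them components of Φ'(x_s), and
smoothness bounds the cost of the replacement by a multiple of ‖y_k − x_s‖. On a bounded set the
averages move by at most a multiple of a_k / A_k per step, so this distance is at most R (a_s + A_k
− A_s) / A_s (`norm_average_sub_extrapolation_le`).

The step sizes make A_k grow like log log k. A polynomial delay changes log k by a bounded factor
only, hence A_k − A_s is bounded and the distance is O(1 / A_k) (`staleness_div_le`). The errors add
up to a multiple of ∑ a_k / A_k, which is at most 1 + log (A_n / A_1), so the gap is O(log A_n /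
A_n). -/

/-! ### Derivatives relative to convex sets, and dual averaging. -/

/-- A seminorm on a finite-dimensional space is dominated by the norm. -/
lemma Seminorm.exists_le_norm_of_finiteDimensional {V : Type*} [NormedAddCommGroup V]
    [NormedSpace ℝ V] [FiniteDimensional ℝ V] (p : Seminorm ℝ V) :
    ∃ C : ℝ, 0 < C ∧ ∀ v, p v ≤ C * ‖v‖ := by
  have hc : Continuous p := by
    rw [← continuousOn_univ]
    exact ConvexOn.continuousOn isOpen_univ p.convexOn
  exact p.bound_of_continuous_normedSpace hc

/-- The gradient inequality for a convex function and a derivative relative to its domain. -/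
lemma ConvexOn.add_fderivWithin_le {V : Type*} [NormedAddCommGroup V] [NormedSpace ℝ V]
    {S : Set V} {f : V → ℝ} (hf : ConvexOn ℝ S f) {x u : V} (hx : x ∈ S) (hu : u ∈ S)
    {f' : StrongDual ℝ V} (hf' : HasFDerivWithinAt f f' S x) :
    f x + f' (u - x) ≤ f u := by
  have hmaps : Set.MapsTo (AffineMap.lineMap x u : ℝ → V) (Set.Icc 0 1) S := by
    intro t ht
    exact hf.1.lineMap_mem hx hu ht
  have hline : HasDerivWithinAt (AffineMap.lineMap x u : ℝ → V) (u - x) (Set.Icc 0 1) 0 :=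
    AffineMap.hasDerivWithinAt_lineMap
  have h0 : HasFDerivWithinAt f f' S (AffineMap.lineMap x u (0 : ℝ)) := by simpa using hf'
  have hd := h0.comp_hasDerivWithinAt (0 : ℝ) hline hmaps
  have hconv : ConvexOn ℝ (Set.Icc (0 : ℝ) 1) (f ∘ (AffineMap.lineMap x u : ℝ →ᵃ[ℝ] V)) :=
    (hf.comp_affineMap (AffineMap.lineMap x u)).subset hmaps (convex_Icc 0 1)
  have h := hconv.le_slope_of_hasDerivWithinAt (by simp) (by simp) zero_lt_one hd
  simp [slope_def_field] at h
  simp only [map_sub]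
  linarith

/-- Two derivatives of the same function relative to a convex set agree on differences of points
of the set. -/
lemma Convex.fderivWithin_sub_unique {V : Type*} [NormedAddCommGroup V] [NormedSpace ℝ V]
    {S : Set V} (hS : Convex ℝ S) {f : V → ℝ} {f₁ f₂ : StrongDual ℝ V} {x u w : V} (hx : x ∈ S)
    (hu : u ∈ S) (hw : w ∈ S) (h₁ : HasFDerivWithinAt f f₁ S x)
    (h₂ : HasFDerivWithinAt f f₂ S x) : f₁ (u - w) = f₂ (u - w) := by
  -- The segment from `x` to `v` lies in `S`, so `v - x` is a tangent direction, where relative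
  -- derivatives are unique.
  have key : ∀ v ∈ S, f₁ (v - x) = f₂ (v - x) := fun v hv =>
    h₁.unique_on h₂ (mem_tangentConeAt_of_segment_subset (hS.segment_subset hx hv))
  have e : u - w = (u - x) - (w - x) := by abel
  rw [e, map_sub, map_sub f₂, key u hu, key w hw]

lemma mirrorMap_spec {V : Type*} [NormedAddCommGroup V] [NormedSpace ℝ V] {X : Set V}
    (hX : IsCompact X) (hne : X.Nonempty) {ψ : V → ℝ} (hψ : ContinuousOn ψ X)
    (z : StrongDual ℝ V) :
    mirrorMap X ψ z ∈ X ∧ IsMaxOn (fun u => z u - ψ u) X (mirrorMap X ψ z) := by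
  have h : ∃ v, v ∈ X ∧ IsMaxOn (fun u => z u - ψ u) X v :=
    hX.exists_isMaxOn hne (z.continuous.continuousOn.sub hψ)
  exact Classical.epsilon_spec h

/-- The "be the leader" bound for dual averaging. -/
lemma be_the_leader {V : Type*} [NormedAddCommGroup V] [NormedSpace ℝ V] {X : Set V}
    {ψ : V → ℝ} {z ξ : ℕ → StrongDual ℝ V} {v : ℕ → V} {γ : ℕ → ℝ}
    (hz : ∀ k, z (k + 1) = z k - γ k • ξ k) (hv : ∀ k, v k ∈ X)
    (hmax : ∀ k, IsMaxOn (fun u => z k u - ψ u) X (v k)) {u : V} (hu : u ∈ X) (n : ℕ) :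
    ∑ k ∈ Finset.range n, γ k * ξ k (v (k + 1) - u) ≤
      (z 0 (v 0) - ψ (v 0)) - (z 0 u - ψ u) := by
  have hsum : ∀ n, ∑ k ∈ Finset.range n, γ k * ξ k (v (k + 1) - u) ≤
      (z 0 (v 0) - ψ (v 0)) - (z n (v n) - ψ (v n)) + (z n u - z 0 u) := by
    intro n
    induction n with
    | zero => simp
    | succ n ih =>
      -- The optimality of `v n` is tested at the next leader `v (n + 1)`, so that the maximal
      -- values telescope.
      have h := hmax n (hv (n + 1))
      simp only [Set.mem_ofPred_eq] at h
      rw [Finset.sum_range_succ]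
      simp only [hz n, sub_apply, smul_apply,
        smul_eq_mul, map_sub] at *
      linarith
  have h := hmax n hu
  simp only [Set.mem_ofPred_eq] at h
  linarith [hsum n]

/-! ### Time stamps under delays. -/

lemma lastStamp_mono (d : ℕ → ℝ) : Monotone (lastStamp d) :=
  monotone_nat_of_le_succ fun _ => le_max_left _ _

lemma one_le_lastStamp (d : ℕ → ℝ) (k : ℕ) : 1 ≤ lastStamp d k :=
  lastStamp_mono d (Nat.zero_le k)

/-- The index is shifted because the initial stamp is 1, which exceeds 0. -/
lemma lastStamp_succ_le (d : ℕ → ℝ) (k : ℕ) : lastStamp d (k + 1) ≤ k + 1 := by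
  have hrec : ∀ k, (received d (k + 1)).sup id ≤ k + 1 := fun k =>
    Finset.sup_le fun t ht => (Finset.mem_Icc.1 (Finset.mem_filter.1 ht).1).2
  induction k with
  | zero => exact max_le le_rfl (hrec 0)
  | succ k ih => exact max_le (ih.trans (Nat.le_succ _)) (hrec (k + 1))

/-- A message that has arrived by iteration `k` is not more recent than the stamp in use. -/
lemma le_lastStamp {d : ℕ → ℝ} {t k : ℕ} (ht : 1 ≤ t) (hd : 0 ≤ d t)
    (h : (t : ℝ) + d t ≤ k) : t ≤ lastStamp d k := by
  -- `m` is the iteration at which the message stamped `t` arrives.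
  obtain ⟨m, hm⟩ : ∃ m, m = ⌈(t : ℝ) + d t⌉₊ := ⟨_, rfl⟩
  have ht' : (1 : ℝ) ≤ t := by exact_mod_cast ht
  have hmk : m ≤ k := hm ▸ Nat.ceil_le.2 h
  have hle : (t : ℝ) + d t ≤ m := hm ▸ Nat.le_ceil _
  have hlt : (m : ℝ) < t + d t + 1 := hm ▸ Nat.ceil_lt_add_one (by linarith)
  have htm : t ≤ m := by
    have : (t : ℝ) ≤ m := by linarith
    exact_mod_cast this
  obtain ⟨n, rfl⟩ : ∃ n, m = n + 1 := ⟨m - 1, by omega⟩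
  refine le_trans ?_ (lastStamp_mono d hmk)
  have hmem : t ∈ received d (n + 1) := by
    rw [received, Finset.mem_filter, Finset.mem_Icc]
    exact ⟨⟨ht, htm⟩, by linarith, hle⟩
  exact (Finset.le_sup (f := id) hmem).trans (le_max_right _ _)

/-- With delays of order `k ^ α` the logarithm of the stamp in use is comparable to that of the
iteration. -/
lemma log_le_log_lastStamp {d : ℕ → ℝ} (hd_nonneg : ∀ k, 1 ≤ k → 0 ≤ d k) {D α : ℝ} (hD : 0 < D)
    (hα : 1 < α) (hd : ∀ k : ℕ, 1 ≤ k → d k ≤ D * (k : ℝ) ^ α) (k : ℕ) :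
    Real.log (k + 1) ≤
      (α + Real.log (2 + D) / Real.log 2) * Real.log ((lastStamp d k : ℝ) + 1) := by
  set s := lastStamp d k with hs
  have hs1 : (1 : ℝ) ≤ s := by exact_mod_cast one_le_lastStamp d k
  -- The message stamped `s + 1` cannot have arrived yet, as otherwise the stamp in use would be at
  -- least `s + 1`.
  have hlt : (k : ℝ) < ((s + 1 : ℕ) : ℝ) + d (s + 1) := by
    by_contra! h
    have := le_lastStamp (by omega) (hd_nonneg _ (by omega)) h
    omega
  have hds := hd (s + 1) (by omega)
  push_cast at hlt hds
  have hpos : (0 : ℝ) < s + 1 := by linarith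
  have h1 : (s : ℝ) + 1 ≤ ((s : ℝ) + 1) ^ α := Real.self_le_rpow_of_one_le (by linarith) hα.le
  have h2 : (k : ℝ) + 1 ≤ (2 + D) * ((s : ℝ) + 1) ^ α := by linarith
  have hlog2 : 0 < Real.log 2 := Real.log_pos one_lt_two
  have hls : Real.log 2 ≤ Real.log ((s : ℝ) + 1) := Real.log_le_log two_pos (by linarith)
  have hlD : 0 ≤ Real.log (2 + D) := Real.log_nonneg (by linarith)
  calc Real.log (k + 1) ≤ Real.log ((2 + D) * ((s : ℝ) + 1) ^ α) :=
        Real.log_le_log (by positivity) h2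
    _ = Real.log (2 + D) + α * Real.log ((s : ℝ) + 1) := by
        rw [Real.log_mul (by positivity) (by positivity), Real.log_rpow hpos]
    _ ≤ Real.log (2 + D) / Real.log 2 * Real.log ((s : ℝ) + 1)
          + α * Real.log ((s : ℝ) + 1) := by
        -- The additive constant is absorbed using `log 2 ≤ log (s + 1)`.
        gcongr
        rw [div_mul_eq_mul_div, le_div_iff₀ hlog2]
        gcongr
    _ = _ := by ring

/-! ### Growth of the sums of steps. -/

@[simp] lemma stepSum_zero (a : ℕ → ℝ) : stepSum a 0 = 0 := by simp [stepSum]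

lemma stepSum_succ (a : ℕ → ℝ) (k : ℕ) : stepSum a (k + 1) = stepSum a k + a (k + 1) :=
  Finset.sum_Icc_succ_top (by omega) _

lemma stepSum_mono {a : ℕ → ℝ} (ha : ∀ k, 1 ≤ k → 0 < a k) : Monotone (stepSum a) :=
  monotone_nat_of_le_succ fun k => by
    rw [stepSum_succ]; linarith [ha (k + 1) (by omega)]

lemma stepSum_pos {a : ℕ → ℝ} (ha : ∀ k, 1 ≤ k → 0 < a k) {k : ℕ} (hk : 1 ≤ k) :
    0 < stepSum a k := by
  have h := stepSum_mono ha hk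
  have h1 : stepSum a 1 = a 1 := by simp [stepSum]
  linarith [ha 1 le_rfl]

/-- The sum of the relative steps grows like the logarithm of the sum of the steps. -/
lemma sum_div_stepSum_le {a : ℕ → ℝ} (ha : ∀ k, 1 ≤ k → 0 < a k) (n : ℕ) :
    ∑ k ∈ Finset.range (n + 1), a (k + 1) / stepSum a (k + 1) ≤
      1 + (Real.log (stepSum a (n + 1)) - Real.log (stepSum a 1)) := by
  induction n with
  | zero =>
    have h1 : stepSum a 1 = a 1 := by simp [stepSum]
    simp [h1, (ha 1 le_rfl).ne']
  | succ n ih =>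
    rw [Finset.sum_range_succ]
    have hp := stepSum_pos ha (k := n + 1) (by omega)
    have hq := stepSum_pos ha (k := n + 1 + 1) (by omega)
    -- With r = A_{n+1} / A_{n+2}, the new term is 1 − r ≤ −log r, which telescopes. The leading 1
    -- is the first term, where A_1 = a_1.
    have h := Real.log_le_sub_one_of_pos (div_pos hp hq)
    rw [Real.log_div hp.ne' hq.ne'] at h
    have e : a (n + 1 + 1) / stepSum a (n + 1 + 1) =
        1 - stepSum a (n + 1) / stepSum a (n + 1 + 1) := by
      rw [eq_sub_iff_add_eq, ← add_div, add_comm, ← stepSum_succ, div_self hq.ne']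
    rw [e]
    linarith

/-- Comparison with the integral of 1 / (t log t), obtained by applying log r ≤ r − 1 to the outer
and to the inner logarithm. -/
lemma log_log_add_one_sub_le {t : ℝ} (ht : 1 < t) :
    Real.log (Real.log (t + 1)) - Real.log (Real.log t) ≤ 1 / (t * Real.log t) := by
  have hl : 0 < Real.log t := Real.log_pos ht
  have hl' : 0 < Real.log (t + 1) := Real.log_pos (by linarith)
  rw [← Real.log_div hl'.ne' hl.ne']
  refine (Real.log_le_sub_one_of_pos (div_pos hl' hl)).trans ?_
  have h := Real.log_le_sub_one_of_pos (x := (t + 1) / t) (by positivity)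
  rw [Real.log_div (by positivity) (by positivity)] at h
  have e : (t + 1) / t - 1 = 1 / t := by field_simp; ring
  rw [e] at h
  rw [div_sub_one hl.ne', ← div_div]
  gcongr

/-- The opposite comparison, at the right endpoint, from 1 − 1/r ≤ log r. -/
lemma le_log_log_add_one_sub {t : ℝ} (ht : 1 < t) :
    1 / ((t + 1) * Real.log (t + 1)) ≤ Real.log (Real.log (t + 1)) - Real.log (Real.log t) := by
  have hl : 0 < Real.log t := Real.log_pos ht
  have hl' : 0 < Real.log (t + 1) := Real.log_pos (by linarith)
  rw [← Real.log_div hl'.ne' hl.ne']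
  refine le_trans ?_ (Real.one_sub_inv_le_log_of_pos (div_pos hl' hl))
  have h := Real.one_sub_inv_le_log_of_pos (x := (t + 1) / t) (by positivity)
  rw [Real.log_div (by positivity) (by positivity), inv_div] at h
  have e : 1 - t / (t + 1) = 1 / (t + 1) := by field_simp; ring
  rw [e] at h
  rw [inv_div, one_sub_div hl'.ne', ← div_div]
  gcongr

section LogSteps

variable {a : ℕ → ℝ} {a₀ : ℝ}

lemma logStep_pos (ha₀ : 0 < a₀)
    (ha : ∀ k : ℕ, 1 ≤ k → a k = a₀ / (((k : ℝ) + 1) * Real.log ((k : ℝ) + 1)))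
    (k : ℕ) (hk : 1 ≤ k) : 0 < a k := by
  have hk' : (1 : ℝ) ≤ k := by exact_mod_cast hk
  have := Real.log_pos (x := (k : ℝ) + 1) (by linarith)
  rw [ha k hk]
  positivity

lemma logStep_le (ha₀ : 0 < a₀)
    (ha : ∀ k : ℕ, 1 ≤ k → a k = a₀ / (((k : ℝ) + 1) * Real.log ((k : ℝ) + 1)))
    {k : ℕ} (hk : 1 ≤ k) : a k ≤ a 1 := by
  have hk' : (1 : ℝ) ≤ k := by exact_mod_cast hk
  have h2 := Real.log_pos one_lt_two
  have h2' : (0 : ℝ) < Real.log (1 + 1) := by norm_num; exact h2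
  rw [ha k hk, ha 1 le_rfl, Nat.cast_one]
  gcongr

lemma le_stepSum_of_logStep (ha₀ : 0 < a₀)
    (ha : ∀ k : ℕ, 1 ≤ k → a k = a₀ / (((k : ℝ) + 1) * Real.log ((k : ℝ) + 1))) (k : ℕ) :
    a₀ * (Real.log (Real.log ((k : ℝ) + 2)) - Real.log (Real.log 2)) ≤ stepSum a k := by
  induction k with
  | zero => simp
  | succ k ih =>
    have h := log_log_add_one_sub_le (t := (k : ℝ) + 2) (by linarith [k.cast_nonneg (α := ℝ)])
    have h' := mul_le_mul_of_nonneg_left h ha₀.le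
    have e : (k : ℝ) + 1 + 1 = k + 2 := by ring
    have e' : (k : ℝ) + 1 + 2 = k + 2 + 1 := by ring
    rw [stepSum_succ, ha (k + 1) (by omega)]
    push_cast
    rw [e, e', ← mul_one_div]
    linarith

/-- Serves twice: for the steps made since a stamp, and with `s = 1` for the growth of the whole
sum. -/
lemma stepSum_sub_le_of_logStep (ha₀ : 0 < a₀)
    (ha : ∀ k : ℕ, 1 ≤ k → a k = a₀ / (((k : ℝ) + 1) * Real.log ((k : ℝ) + 1)))
    {s k : ℕ} (hs : 1 ≤ s) (hsk : s ≤ k) :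
    stepSum a k - stepSum a s ≤
      a₀ * (Real.log (Real.log ((k : ℝ) + 1)) - Real.log (Real.log ((s : ℝ) + 1))) := by
  induction k, hsk using Nat.le_induction with
  | base => simp
  | succ k hk ih =>
    have hk' : (1 : ℝ) ≤ k := by exact_mod_cast hs.trans hk
    have h := le_log_log_add_one_sub (t := (k : ℝ) + 1) (by linarith)
    have h' := mul_le_mul_of_nonneg_left h ha₀.le
    rw [stepSum_succ, ha (k + 1) (by omega)]
    push_cast
    rw [← mul_one_div]
    linarith

/-- Under delays of polynomial order the steps made since the stamp in use have bounded sum. -/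
lemma stepSum_sub_lastStamp_le (ha₀ : 0 < a₀)
    (ha : ∀ k : ℕ, 1 ≤ k → a k = a₀ / (((k : ℝ) + 1) * Real.log ((k : ℝ) + 1)))
    {d : ℕ → ℝ} (hd_nonneg : ∀ k, 1 ≤ k → 0 ≤ d k) {D α : ℝ} (hD : 0 < D)
    (hα : 1 < α) (hd : ∀ k : ℕ, 1 ≤ k → d k ≤ D * (k : ℝ) ^ α) (k : ℕ) :
    stepSum a (k + 1) - stepSum a (lastStamp d (k + 1)) ≤
      a₀ * Real.log (α + Real.log (2 + D) / Real.log 2) := by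
  have hs := one_le_lastStamp d (k + 1)
  refine (stepSum_sub_le_of_logStep ha₀ ha hs (lastStamp_succ_le d k)).trans ?_
  have h := log_le_log_lastStamp hd_nonneg hD hα hd (k + 1)
  have hs' : (1 : ℝ) ≤ lastStamp d (k + 1) := by exact_mod_cast hs
  have hls : 0 < Real.log ((lastStamp d (k + 1) : ℝ) + 1) := Real.log_pos (by linarith)
  have hlk : 0 < Real.log (((k + 1 : ℕ) : ℝ) + 1) :=
    Real.log_pos (by push_cast; linarith [k.cast_nonneg (α := ℝ)])
  have hlD : 0 ≤ Real.log (2 + D) / Real.log 2 :=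
    div_nonneg (Real.log_nonneg (by linarith)) (Real.log_nonneg one_le_two)
  have h' := Real.log_le_log hlk h
  rw [Real.log_mul (by linarith) hls.ne'] at h'
  gcongr
  linarith

end LogSteps

/-! ### Averaged and extrapolated iterates. -/

section Averaging

variable {V : Type*} [NormedAddCommGroup V] [NormedSpace ℝ V] {K : Set V} {a : ℕ → ℝ}
  {x y v : ℕ → V}

lemma average_mem (hK : Convex ℝ K) (ha : ∀ k, 1 ≤ k → 0 < a k) (hv : ∀ k, v k ∈ K)
    (hy : ∀ k, y (k + 1) = (stepSum a k / stepSum a (k + 1)) • y k +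
      (a (k + 1) / stepSum a (k + 1)) • v (k + 1)) (k : ℕ) : y (k + 1) ∈ K := by
  induction k with
  -- As A_0 = 0, the first average is `v 1`; `y 0` need not lie in `K`.
  | zero =>
    have h1 : stepSum a 1 = a 1 := by simp [stepSum]
    rw [hy 0]
    simpa [h1, (ha 1 le_rfl).ne'] using hv 1
  | succ k ih =>
    have hp := stepSum_pos ha (k := k + 1) (by omega)
    have hq := stepSum_pos ha (k := k + 1 + 1) (by omega)
    rw [hy (k + 1)]
    refine hK ih (hv _) (by positivity) (div_nonneg (ha _ (by omega)).le hq.le) ?_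
    rw [← add_div, ← stepSum_succ, div_self hq.ne']

lemma extrapolation_mem (hK : Convex ℝ K) (ha : ∀ k, 1 ≤ k → 0 < a k) (hv : ∀ k, v k ∈ K)
    (hy : ∀ k, y (k + 1) ∈ K) (hx1 : x 1 ∈ K)
    (hx : ∀ k, x (k + 2) = (stepSum a (k + 1) / stepSum a (k + 2)) • y (k + 1) +
      (a (k + 2) / stepSum a (k + 2)) • v (k + 1)) {k : ℕ} (hk : 1 ≤ k) : x k ∈ K := by
  match k, hk with
  | 1, _ => exact hx1
  | k + 2, _ =>
    have hp := stepSum_pos ha (k := k + 1) (by omega)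
    have hq := stepSum_pos ha (k := k + 2) (by omega)
    rw [hx k]
    refine hK (hy k) (hv _) (by positivity) (div_nonneg (ha _ (by omega)).le hq.le) ?_
    rw [← add_div, ← stepSum_succ, div_self hq.ne']

/-- The term a_s accounts for the gap between y_s and x_s, and A_k − A_s for the drift of the
averages from s to k; both use only the diameter of `K`. -/
lemma norm_average_sub_extrapolation_le (ha : ∀ k, 1 ≤ k → 0 < a k)
    (hv : ∀ k, v k ∈ K) {R : ℝ} (hR : ∀ u ∈ K, ∀ w ∈ K, ‖u - w‖ ≤ R)
    (hy : ∀ k, y (k + 1) = (stepSum a k / stepSum a (k + 1)) • y k +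
      (a (k + 1) / stepSum a (k + 1)) • v (k + 1)) (hyK : ∀ k, y (k + 1) ∈ K) (hx1 : x 1 ∈ K)
    (hx : ∀ k, x (k + 2) = (stepSum a (k + 1) / stepSum a (k + 2)) • y (k + 1) +
      (a (k + 2) / stepSum a (k + 2)) • v (k + 1)) {s k : ℕ} (hs : 1 ≤ s) (hsk : s ≤ k) :
    ‖y k - x s‖ ≤ R * ((a s + (stepSum a k - stepSum a s)) / stepSum a s) := by
  have hR0 : 0 ≤ R := (norm_nonneg _).trans (hR _ hx1 _ hx1)
  have hAs := stepSum_pos ha hs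
  induction k, hsk using Nat.le_induction with
  | base =>
    rw [sub_self, add_zero]
    match s, hs with
    | 1, _ =>
      have h1 : stepSum a 1 = a 1 := by simp [stepSum]
      rw [h1, div_self (ha 1 le_rfl).ne', mul_one]
      exact hR _ (hyK 0) _ hx1
    | s + 2, _ =>
      -- Both points carry the same multiple of `y (s + 1)` and differ only in the mirror point.
      have e : y (s + 2) - x (s + 2) = (a (s + 2) / stepSum a (s + 2)) • (v (s + 2) - v (s + 1)) := by
        rw [hy (s + 1), hx s, smul_sub]; abel
      rw [e, norm_smul, Real.norm_of_nonneg (div_nonneg (ha _ (by omega)).le hAs.le), mul_comm]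
      exact mul_le_mul_of_nonneg_right (hR _ (hv _) _ (hv _))
        (div_nonneg (ha _ (by omega)).le hAs.le)
  | succ k hk ih =>
    have hq := stepSum_pos ha (k := k + 1) (by omega)
    have hak := ha (k + 1) (by omega)
    have e : y (k + 1) - y k = (a (k + 1) / stepSum a (k + 1)) • (v (k + 1) - y k) := by
      have h1 : stepSum a k / stepSum a (k + 1) = 1 - a (k + 1) / stepSum a (k + 1) := by
        rw [eq_sub_iff_add_eq, ← add_div, ← stepSum_succ, div_self hq.ne']
      rw [hy k, h1, sub_smul, one_smul, smul_sub]; abel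
    have hyk : y k ∈ K := by
      obtain ⟨n, rfl⟩ : ∃ n, k = n + 1 := ⟨k - 1, by omega⟩
      exact hyK n
    have hstep : ‖y (k + 1) - y k‖ ≤ R * (a (k + 1) / stepSum a s) := by
      rw [e, norm_smul, Real.norm_of_nonneg (by positivity), mul_comm]
      gcongr
      · exact hR _ (hv _) _ hyk
      · exact stepSum_mono ha (by omega)
    calc ‖y (k + 1) - x s‖ ≤ ‖y (k + 1) - y k‖ + ‖y k - x s‖ := norm_sub_le_norm_sub_add_norm_sub _ _ _
      _ ≤ R * (a (k + 1) / stepSum a s) +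
          R * ((a s + (stepSum a k - stepSum a s)) / stepSum a s) := add_le_add hstep ih
      _ = _ := by rw [stepSum_succ]; ring

end Averaging

/-- One step of averaging for a convex function. -/
lemma ConvexOn.stepSum_mul_sub_le {V : Type*} [NormedAddCommGroup V] [NormedSpace ℝ V]
    {K : Set V} {f : V → ℝ} (hf : ConvexOn ℝ K f) {a : ℕ → ℝ} (ha : ∀ k, 1 ≤ k → 0 < a k)
    {y v : ℕ → V}
    (hy : ∀ k, y (k + 1) = (stepSum a k / stepSum a (k + 1)) • y k +
      (a (k + 1) / stepSum a (k + 1)) • v (k + 1)) (hyK : ∀ k, y (k + 1) ∈ K)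
    {f' : V → StrongDual ℝ V} (hf' : ∀ w ∈ K, HasFDerivWithinAt f (f' w) K w)
    {u : V} (hu : u ∈ K) (k : ℕ) :
    stepSum a (k + 1) * (f (y (k + 1)) - f u) ≤
      stepSum a k * (f (y k) - f u) + a (k + 1) * f' (y (k + 1)) (v (k + 1) - u) := by
  have hq := stepSum_pos ha (k := k + 1) (by omega)
  have hak := ha (k + 1) (by omega)
  have h1 := mul_le_mul_of_nonneg_left
    (hf.add_fderivWithin_le (hyK k) hu (hf' _ (hyK k))) hak.le
  -- The gradient inequality at the new average is used towards `u` with weight a_{k+1} and towards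
  -- the old average with weight A_k; the latter is 0 when `k = 0`.
  have h2 : stepSum a k * (f (y (k + 1)) + f' (y (k + 1)) (y k - y (k + 1))) ≤
      stepSum a k * f (y k) := by
    rcases Nat.eq_zero_or_pos k with rfl | hk
    · simp
    · obtain ⟨n, rfl⟩ : ∃ n, k = n + 1 := ⟨k - 1, by omega⟩
      exact mul_le_mul_of_nonneg_left (hf.add_fderivWithin_le (hyK _) (hyK n) (hf' _ (hyK _)))
        (stepSum_pos ha hk).le
  have h3 : stepSum a (k + 1) * f' (y (k + 1)) (y (k + 1)) =
      stepSum a k * f' (y (k + 1)) (y k) + a (k + 1) * f' (y (k + 1)) (v (k + 1)) := by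
    have e : stepSum a (k + 1) • y (k + 1) = stepSum a k • y k + a (k + 1) • v (k + 1) := by
      conv_lhs => rw [hy k]
      rw [smul_add, smul_smul, smul_smul, mul_div_cancel₀ _ hq.ne', mul_div_cancel₀ _ hq.ne']
    have := congrArg (f' (y (k + 1))) e
    simpa only [map_smul, map_add, smul_eq_mul] using this
  rw [stepSum_succ] at h3 ⊢
  simp only [map_sub] at *
  linarith

/-! ### From the game to the regret bound and the rate. -/

/-- On differences of actions the partial gradient of a cost is that of the potential. -/
lemma IsPotential.partialGradient_apply {N : ℕ} {E : Fin N → Type*} [∀ i, NormedAddCommGroup (E i)]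
    [∀ i, NormedSpace ℝ (E i)] {X : ∀ i, Set (E i)} (hXconv : ∀ i, Convex ℝ (X i))
    {J : Fin N → (∀ i, E i) → ℝ} {Φ : (∀ i, E i) → ℝ} (hΦ : IsPotential X J Φ)
    {g : ∀ i, (∀ j, E j) → StrongDual ℝ (E i)} (hg : IsPartialGradient X J g)
    {x : ∀ i, E i} (hx : x ∈ Set.univ.pi X) {f' : StrongDual ℝ (∀ i, E i)}
    (hf' : HasFDerivWithinAt Φ f' (Set.univ.pi X) x) (i : Fin N) {u w : E i} (hu : u ∈ X i)
    (hw : w ∈ X i) : g i x (u - w) = f' (Pi.single i (u - w)) := by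
  have hxi : x i ∈ X i := hx i (Set.mem_univ i)
  have hupd : HasFDerivWithinAt (Function.update x i)
      (ContinuousLinearMap.single ℝ E i) (X i) (x i) := by
    have h := (hasFDerivAt_update (𝕜 := ℝ) x (x i)).hasFDerivWithinAt (s := X i)
    convert h using 1
    ext v : 1
    ext j
    by_cases hj : j = i
    · subst hj; simp
    · simp [hj, ContinuousLinearMap.pi_apply]
  have hmaps : Set.MapsTo (Function.update x i) (X i) (Set.univ.pi X) := by
    intro u hu j _
    by_cases hj : j = i
    · subst hj; simpa using hu
    · simpa [hj] using hx j (Set.mem_univ j)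
  have hf0 : HasFDerivWithinAt Φ f' (Set.univ.pi X) (Function.update x i (x i)) := by
    simpa using hf'
  have hcomp := hf0.comp (x i) hupd hmaps
  -- As functions of player `i`'s action alone, `J i` and `Φ` differ by a constant.
  have hΦi : HasFDerivWithinAt (fun u => Φ (Function.update x i u)) (g i x) (X i) (x i) := by
    have h := (hg i x hx).add_const
      (Φ (Function.update x i (x i)) - J i (Function.update x i (x i)))
    refine h.congr (fun u hu => ?_) ?_
    · linarith [hΦ i x hx u hu (x i) hxi]
    · ring
  exact (hXconv i).fderivWithin_sub_unique hxi hu hw hΦi hcomp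

/-- The scaled distance bound to the stale iterate, in terms of the current sum of steps. -/
lemma staleness_div_le {a : ℕ → ℝ} {a₀ : ℝ} (ha₀ : 0 < a₀)
    (ha : ∀ k : ℕ, 1 ≤ k → a k = a₀ / (((k : ℝ) + 1) * Real.log ((k : ℝ) + 1)))
    {D α : ℝ} (hD : 0 < D) (hα : 1 < α) : ∃ B : ℝ, 0 ≤ B ∧ ∀ d : ℕ → ℝ,
      (∀ k, 1 ≤ k → 0 ≤ d k) → (∀ k : ℕ, 1 ≤ k → d k ≤ D * (k : ℝ) ^ α) → ∀ k,
        (a (lastStamp d (k + 1)) + (stepSum a (k + 1) - stepSum a (lastStamp d (k + 1)))) /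
          stepSum a (lastStamp d (k + 1)) ≤ B / stepSum a (k + 1) := by
  have hpos := logStep_pos ha₀ ha
  have hA1 := stepSum_pos hpos le_rfl
  have ha1 := hpos 1 le_rfl
  have hlD : 0 ≤ Real.log (2 + D) / Real.log 2 :=
    div_nonneg (Real.log_nonneg (by linarith)) (Real.log_nonneg one_le_two)
  have hlog : 0 ≤ Real.log (α + Real.log (2 + D) / Real.log 2) := Real.log_nonneg (by linarith)
  set b := a 1 + a₀ * Real.log (α + Real.log (2 + D) / Real.log 2) with hb
  have hb1 : 0 ≤ a₀ * Real.log (α + Real.log (2 + D) / Real.log 2) := by positivity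
  have hb0 : 0 ≤ b := by positivity
  refine ⟨b * (1 + b / stepSum a 1), by positivity, fun d hd_nonneg hd k => ?_⟩
  have hstale := stepSum_sub_lastStamp_le ha₀ ha hd_nonneg hD hα hd k
  have hs := one_le_lastStamp d (k + 1)
  generalize lastStamp d (k + 1) = s at *
  have hAs := stepSum_pos hpos hs
  have hAk := stepSum_pos hpos (k := k + 1) (by omega)
  have has := logStep_le ha₀ ha hs
  have hmono := stepSum_mono hpos hs
  -- A_{k+1} ≤ A_s + b, and b is at most (b / A_1) A_s because A_1 ≤ A_s.
  have h1 : stepSum a (k + 1) ≤ (1 + b / stepSum a 1) * stepSum a s := by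
    have : b ≤ b / stepSum a 1 * stepSum a s := by
      rw [div_mul_eq_mul_div, le_div_iff₀ hA1]
      gcongr
    linarith
  rw [div_le_div_iff₀ hAs hAk, mul_assoc]
  refine mul_le_mul (by linarith) h1 hAk.le hb0

/-- The rate obtained from a logarithmic bound on the regret. -/
lemma isBigO_of_stepSum_mul_le {a : ℕ → ℝ} {a₀ : ℝ} (ha₀ : 0 < a₀)
    (ha : ∀ k : ℕ, 1 ≤ k → a k = a₀ / (((k : ℝ) + 1) * Real.log ((k : ℝ) + 1)))
    {δ : ℕ → ℝ} (hδ : ∀ k, 0 ≤ δ (k + 1)) {C₀ C₁ : ℝ} (hC₁ : 0 ≤ C₁)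
    (h : ∀ k, stepSum a (k + 1) * δ (k + 1) ≤ C₀ + C₁ * Real.log (stepSum a (k + 1))) :
    δ =O[atTop] fun k : ℕ =>
      Real.log (Real.log (Real.log (k : ℝ))) / Real.log (Real.log (k : ℝ)) := by
  have hpos := logStep_pos ha₀ ha
  have ha1 := hpos 1 le_rfl
  have hlog2 := Real.log_pos one_lt_two
  have hL2 : Tendsto (fun k : ℕ => Real.log (Real.log (k : ℝ))) atTop atTop :=
    Real.tendsto_log_atTop.comp (Real.tendsto_log_atTop.comp tendsto_natCast_atTop_atTop)
  have hL3 : Tendsto (fun k : ℕ => Real.log (Real.log (Real.log (k : ℝ)))) atTop atTop :=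
    Real.tendsto_log_atTop.comp hL2
  set Q := a 1 + a₀ * (Real.log 2 + |Real.log (Real.log 2)|) + a₀ with hQ
  have hQ0 : 0 < Q := by positivity
  refine IsBigO.of_bound ((|C₀ + C₁ * Real.log Q| + C₁) / a₀) ?_
  -- Once both iterated logarithms are at least 1, they absorb the additive constants.
  filter_upwards [hL2.eventually_ge_atTop 1, hL3.eventually_ge_atTop 1, eventually_ge_atTop 2]
    with k h2 h3 hk
  have hk2 : (2 : ℝ) ≤ k := by exact_mod_cast hk
  have hlk : 0 < Real.log (k : ℝ) := Real.log_pos (by linarith)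
  obtain ⟨n, rfl⟩ : ∃ n, k = n + 1 := ⟨k - 1, by omega⟩
  have hreg := h n
  have hδn := hδ n
  generalize n + 1 = k at *
  have hA := stepSum_pos hpos (k := k) (by omega)
  have hlow : a₀ * Real.log (Real.log (k : ℝ)) ≤ stepSum a k := by
    refine le_trans ?_ (le_stepSum_of_logStep ha₀ ha k)
    have e1 : Real.log (Real.log (k : ℝ)) ≤ Real.log (Real.log ((k : ℝ) + 2)) := by
      gcongr; linarith
    have e2 : Real.log (Real.log 2) ≤ 0 :=
      Real.log_nonpos hlog2.le (by linarith [Real.log_two_lt_d9])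
    gcongr
    linarith
  have hup : stepSum a k ≤ Q * Real.log (Real.log (k : ℝ)) := by
    have e0 := stepSum_sub_le_of_logStep ha₀ ha (le_refl 1) (show 1 ≤ k by omega)
    have e1 : stepSum a 1 = a 1 := by simp [stepSum]
    -- From k + 1 ≤ k² for k ≥ 2.
    have e2 : Real.log (Real.log ((k : ℝ) + 1)) ≤ Real.log 2 + Real.log (Real.log (k : ℝ)) := by
      rw [← Real.log_mul two_ne_zero hlk.ne']
      apply Real.log_le_log (Real.log_pos (by linarith))
      have : (2 : ℝ) * Real.log k = Real.log ((k : ℝ) ^ 2) := by rw [Real.log_pow]; norm_num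
      rw [this]
      apply Real.log_le_log (by linarith)
      nlinarith
    have e3 : ((1 : ℕ) : ℝ) + 1 = 2 := by norm_num
    rw [e1, e3] at e0
    have e4 : stepSum a k ≤ a 1 + a₀ * (Real.log 2 + |Real.log (Real.log 2)|)
        + a₀ * Real.log (Real.log (k : ℝ)) := by
      have := mul_le_mul_of_nonneg_left
        (sub_le_sub e2 (neg_abs_le (Real.log (Real.log 2)))) ha₀.le
      linarith
    have e5 : 0 ≤ a 1 + a₀ * (Real.log 2 + |Real.log (Real.log 2)|) := by positivity
    have e6 := le_mul_of_one_le_right e5 h2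
    rw [hQ, add_mul]
    linarith
  have hlogA : Real.log (stepSum a k) ≤
      Real.log Q + Real.log (Real.log (Real.log (k : ℝ))) := by
    rw [← Real.log_mul hQ0.ne' (by linarith)]
    exact Real.log_le_log hA hup
  have hfin : a₀ * Real.log (Real.log (k : ℝ)) * δ k ≤
      (|C₀ + C₁ * Real.log Q| + C₁) * Real.log (Real.log (Real.log (k : ℝ))) := by
    have e1 := mul_le_mul_of_nonneg_right hlow hδn
    have e2 := mul_le_mul_of_nonneg_left hlogA hC₁
    have e3 := le_abs_self (C₀ + C₁ * Real.log Q)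
    have e4 := le_mul_of_one_le_right (abs_nonneg (C₀ + C₁ * Real.log Q)) h3
    linarith
  rw [Real.norm_of_nonneg hδn, Real.norm_of_nonneg (div_nonneg (by linarith) (by linarith)),
    div_mul_div_comm, le_div_iff₀ (by nlinarith)]
  linarith

/-- A bound on the regret of the averaged iterates, logarithmic in the sum of the steps. -/
lemma exists_regret_bound {N : ℕ} {E : Fin N → Type*} [∀ i, NormedAddCommGroup (E i)]
    [∀ i, NormedSpace ℝ (E i)] [∀ i, FiniteDimensional ℝ (E i)]
    {X : ∀ i, Set (E i)} (hXconv : ∀ i, Convex ℝ (X i)) (hXbdd : ∀ i, Bornology.IsBounded (X i))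
    {J : Fin N → (∀ i, E i) → ℝ} {g : ∀ i, (∀ j, E j) → StrongDual ℝ (E i)}
    (hg : IsPartialGradient X J g) {Φ : (∀ i, E i) → ℝ} (hΦ : IsPotential X J Φ)
    (hΦconv : ConvexOn ℝ (Set.univ.pi X) Φ) {p : Seminorm ℝ (∀ i, E i)} {L : ℝ} (hL : 0 < L)
    (hΦsmooth : IsLSmoothOn p L (Set.univ.pi X) Φ) {ψ : ∀ i, E i → ℝ}
    (hmirror : ∀ i z, mirrorMap (X i) (ψ i) z ∈ X i ∧
      IsMaxOn (fun u => z u - ψ i u) (X i) (mirrorMap (X i) (ψ i) z))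
    {d : Fin N → ℕ → ℝ} {a : ℕ → ℝ} (ha : ∀ k, 1 ≤ k → 0 < a k) {B : ℝ}
    (hB : ∀ i k, (a (lastStamp (d i) (k + 1)) +
      (stepSum a (k + 1) - stepSum a (lastStamp (d i) (k + 1)))) /
        stepSum a (lastStamp (d i) (k + 1)) ≤ B / stepSum a (k + 1)) (hB0 : 0 ≤ B)
    {x y : ℕ → ∀ i, E i} {z : ℕ → ∀ i, StrongDual ℝ (E i)} (hrun : IsDelayedRun X ψ g a d x y z)
    {u : ∀ i, E i} (hu : u ∈ Set.univ.pi X) :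
    (∀ k, y (k + 1) ∈ Set.univ.pi X) ∧ ∃ C₀ C₁ : ℝ, 0 ≤ C₁ ∧ ∀ n,
      stepSum a (n + 1) * (Φ (y (n + 1)) - Φ u) ≤ C₀ + C₁ * Real.log (stepSum a (n + 1)) := by
  set K := Set.univ.pi X with hK
  set v : ℕ → ∀ i, E i := fun k i => mirrorMap (X i) (ψ i) (z k i) with hv_def
  have hKconv : Convex ℝ K := convex_pi fun i _ => hXconv i
  have hKbdd : Bornology.IsBounded K := Bornology.IsBounded.pi hXbdd
  have hvX : ∀ k i, v k i ∈ X i := fun k i => (hmirror i (z k i)).1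
  have hv : ∀ k, v k ∈ K := fun k i _ => hvX k i
  have hy : ∀ k, y (k + 1) = (stepSum a k / stepSum a (k + 1)) • y k +
      (a (k + 1) / stepSum a (k + 1)) • v (k + 1) := fun k => funext fun i => hrun.y_succ k i
  have hx : ∀ k, x (k + 2) = (stepSum a (k + 1) / stepSum a (k + 2)) • y (k + 1) +
      (a (k + 2) / stepSum a (k + 2)) • v (k + 1) := fun k => funext fun i => hrun.x_succ k i
  have hx1 : x 1 ∈ K := by
    rw [hrun.x_one]; exact fun i _ => hrun.x_zero_mem i
  have hyK := average_mem hKconv ha hv hy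
  have hxK : ∀ k, 1 ≤ k → x k ∈ K := fun k hk => extrapolation_mem hKconv ha hv hyK hx1 hx hk
  refine ⟨hyK, ?_⟩
  obtain ⟨R, hR⟩ : ∃ R : ℝ, ∀ u ∈ K, ∀ w ∈ K, ‖u - w‖ ≤ R := by
    obtain ⟨R, hR⟩ := Metric.isBounded_iff.1 hKbdd
    exact ⟨R, fun u hu w hw => by rw [← dist_eq_norm]; exact hR hu hw⟩
  have hR0 : 0 ≤ R := (norm_nonneg _).trans (hR _ hx1 _ hx1)
  obtain ⟨C, hC, hpC⟩ := p.exists_le_norm_of_finiteDimensional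
  obtain ⟨f', hf', hlip⟩ := hΦsmooth
  -- Smoothness constant, times the bound on the `p`-distance to the stale point without its factor
  -- 1 / A_{k+1}, times the `p`-size of one player's displacement.
  set M := L * (C * (R * B)) * (C * R) with hM
  have hM0 : 0 ≤ M := by positivity
  set ξ : ∀ _ : Fin N, ℕ → StrongDual ℝ (E _) :=
    fun i k => g i (x (lastStamp (d i) (k + 1))) with hξ
  -- Players may use different stamps, so the stale gradients need not come from one profile; the
  -- comparison is made one component at a time.
  have hplayer : ∀ k i, f' (y (k + 1)) (Pi.single i (v (k + 1) i - u i)) ≤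
      ξ i k (v (k + 1) i - u i) + M / stepSum a (k + 1) := by
    intro k i
    have hAk := stepSum_pos ha (k := k + 1) (by omega)
    have hs := one_le_lastStamp (d i) (k + 1)
    have hxs := hxK _ hs
    have e1 : ξ i k (v (k + 1) i - u i) = _ :=
      hΦ.partialGradient_apply hXconv hg hxs (hf' _ hxs) i (hvX (k + 1) i) (hu i (Set.mem_univ i))
    have e2 := (le_abs_self _).trans
      (hlip _ (hyK k) _ hxs (Pi.single i (v (k + 1) i - u i)))
    have e3 : p (y (k + 1) - x (lastStamp (d i) (k + 1))) ≤
        C * (R * (B / stepSum a (k + 1))) := by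
      refine (hpC _).trans ?_
      gcongr
      refine (norm_average_sub_extrapolation_le ha hv hR hy hyK hx1 hx hs
        (lastStamp_succ_le (d i) k)).trans ?_
      exact mul_le_mul_of_nonneg_left (hB i k) hR0
    have e4 : p (Pi.single i (v (k + 1) i - u i)) ≤ C * R := by
      refine (hpC _).trans ?_
      rw [Pi.norm_single]
      gcongr
      exact (norm_le_pi_norm (v (k + 1) - u) i).trans (hR _ (hv _) _ hu)
    have e5 : L * p (y (k + 1) - x (lastStamp (d i) (k + 1))) *
        p (Pi.single i (v (k + 1) i - u i)) ≤ M / stepSum a (k + 1) := by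
      calc _ ≤ L * (C * (R * (B / stepSum a (k + 1)))) * (C * R) := by gcongr
        _ = _ := by rw [hM]; ring
    rw [sub_apply] at e2
    rw [e1]
    linarith
  have hstep : ∀ k, a (k + 1) * f' (y (k + 1)) (v (k + 1) - u) ≤
      ∑ i, a (k + 1) * ξ i k (v (k + 1) i - u i) +
        N * M * (a (k + 1) / stepSum a (k + 1)) := by
    intro k
    have e : f' (y (k + 1)) (v (k + 1) - u) =
        ∑ i, f' (y (k + 1)) (Pi.single i (v (k + 1) i - u i)) := by
      rw [← map_sum]
      congr 1
      exact (Finset.univ_sum_single (v (k + 1) - u)).symm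
    have h := mul_le_mul_of_nonneg_left (Finset.sum_le_sum fun i (_ : i ∈ Finset.univ) => hplayer k i)
      (ha (k + 1) (by omega)).le
    rw [Finset.sum_add_distrib, Finset.sum_const, Finset.card_univ, Fintype.card_fin,
      nsmul_eq_mul] at h
    rw [e, ← Finset.mul_sum]
    refine h.trans (le_of_eq ?_)
    ring
  set R₀ : ℝ := ∑ i, ((z 0 i (v 0 i) - ψ i (v 0 i)) - (z 0 i (u i) - ψ i (u i))) with hR₀
  have hlead : ∀ n, ∑ k ∈ Finset.range n, ∑ i, a (k + 1) * ξ i k (v (k + 1) i - u i) ≤ R₀ := by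
    intro n
    rw [Finset.sum_comm]
    exact Finset.sum_le_sum fun i _ => be_the_leader (X := X i) (ψ := ψ i) (z := fun k => z k i)
      (v := fun k => v k i) (γ := fun k => a (k + 1)) (fun k => hrun.z_succ k i)
      (fun k => hvX k i) (fun k => (hmirror i (z k i)).2) (hu i (Set.mem_univ i)) n
  have hsum : ∀ n, stepSum a n * (Φ (y n) - Φ u) ≤
      ∑ k ∈ Finset.range n, a (k + 1) * f' (y (k + 1)) (v (k + 1) - u) := by
    intro n
    induction n with
    | zero => simp
    | succ n ih =>
      rw [Finset.sum_range_succ]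
      linarith [hΦconv.stepSum_mul_sub_le ha hy hyK hf' hu n]
  refine ⟨R₀ + N * M * (1 - Real.log (stepSum a 1)), N * M, by positivity, fun n => ?_⟩
  have h1 := (hsum (n + 1)).trans (Finset.sum_le_sum fun k _ => hstep k)
  rw [Finset.sum_add_distrib, ← Finset.mul_sum] at h1
  have h2 := mul_le_mul_of_nonneg_left (sum_div_stepSum_le ha n)
    (show 0 ≤ (N : ℝ) * M by positivity)
  linarith [hlead (n + 1)]

theorem corollary2 {N : ℕ} {E : Fin N → Type*} [∀ i, NormedAddCommGroup (E i)]
    [∀ i, NormedSpace ℝ (E i)] [∀ i, FiniteDimensional ℝ (E i)]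
    -- strategy spaces
    (X : ∀ i, Set (E i)) (hXne : ∀ i, (X i).Nonempty) (hXcl : ∀ i, IsClosed (X i))
    (hXconv : ∀ i, Convex ℝ (X i)) (hXbdd : ∀ i, Bornology.IsBounded (X i))
    -- objectives and their partial gradients
    (J : Fin N → (∀ i, E i) → ℝ) (hJ : ∀ i, ContDiffOn ℝ 1 (J i) (Set.univ.pi X))
    (g : ∀ i, (∀ j, E j) → StrongDual ℝ (E i)) (hg : IsPartialGradient X J g)
    -- convex potential, smooth with respect to some norm on the joint action space
    (Φ : (∀ i, E i) → ℝ) (hΦ : IsPotential X J Φ) (hΦconv : ConvexOn ℝ (Set.univ.pi X) Φ)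
    (p : Seminorm ℝ (∀ i, E i)) (hp : ∀ v, p v = 0 → v = 0)
    (L : ℝ) (hL : 0 < L) (hΦsmooth : IsLSmoothOn p L (Set.univ.pi X) Φ)
    -- regularizers
    (ψ : ∀ i, E i → ℝ) (μ : Fin N → ℝ) (hμ : ∀ i, 0 < μ i)
    (hψ : ∀ i, StrongConvexOn (X i) (μ i) (ψ i)) (hψcont : ∀ i, ContinuousOn (ψ i) (X i))
    -- delays with a superlinear bound
    (d : Fin N → ℕ → ℝ) (hd_nonneg : ∀ i k, 1 ≤ k → 0 ≤ d i k)
    (D α : ℝ) (hD : 0 < D) (hα : 1 < α) (hd : ∀ i (k : ℕ), 1 ≤ k → d i k ≤ D * (k : ℝ) ^ α)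
    -- step sizes
    (a : ℕ → ℝ) (a₀ : ℝ) (ha₀ : 0 < a₀)
    (ha : ∀ k : ℕ, 1 ≤ k → a k = a₀ / (((k : ℝ) + 1) * Real.log ((k : ℝ) + 1)))
    -- a run of the algorithm and a minimizer of the potential
    (x y : ℕ → ∀ i, E i) (z : ℕ → ∀ i, StrongDual ℝ (E i)) (hrun : IsDelayedRun X ψ g a d x y z)
    (xs : ∀ i, E i) (hxs : xs ∈ Set.univ.pi X) (hmin : IsMinOn Φ (Set.univ.pi X) xs) :
    (fun k : ℕ => Φ (y k) - Φ xs) =O[atTop]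
      fun k : ℕ => Real.log (Real.log (Real.log (k : ℝ))) / Real.log (Real.log (k : ℝ)) := by
  have hpos := logStep_pos ha₀ ha
  obtain ⟨B, hB0, hB⟩ := staleness_div_le ha₀ ha hD hα
  have hmirror : ∀ i z, mirrorMap (X i) (ψ i) z ∈ X i ∧
      IsMaxOn (fun u => z u - ψ i u) (X i) (mirrorMap (X i) (ψ i) z) := fun i z =>
    mirrorMap_spec (Metric.isCompact_of_isClosed_isBounded (hXcl i) (hXbdd i)) (hXne i)
      (hψcont i) z
  obtain ⟨hyK, C₀, C₁, hC₁, h⟩ := exists_regret_bound hXconv hXbdd hg hΦ hΦconv hL hΦsmooth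
    hmirror hpos (fun i => hB (d i) (hd_nonneg i) (hd i)) hB0 hrun hxs
  exact isBigO_of_stepSum_mul_le ha₀ ha (fun k => sub_nonneg.2 (hmin (hyK k))) hC₁ h
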